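/- Let $A$ be one of the real $^*$-algebras $\mathbb{C}$, $\mathbb{H}$ (quaternions), $\mathbb{O}$ (octonions), with conjugation $x\mapsto x^c$ and its Euclidean topology, and let $\mathbb{S}=\{J\in A : J^2=-1\}$. The circularization of $E\subseteq\mathbb{C}$ is $\Omega_E=\{\alpha+\beta J : \alpha,\beta\in\mathbb{R},\ J\in\mathbb{S},\ \alpha+i\beta\in E\}\subseteq A$; a subset of $A$ is circular if it equals $\Omega_E$ for some $E\subseteq\mathbb{C}$. Let $D\subseteq\mathbb{C}$ be open and invariant under complex conjugation, and let $\Omega=\Omega_D$. If $D$ is connected and intersects $\mathbb{R}$, then $\Omega$ is called a slice domain. A function $f:\Omega\to A$ is slice regular if there are continuously differentiable $F_1,F_2:D\to A$ with $F_1(\bar z)=F_1(z)$, $F_2(\bar z)=-F_2(z)$, $$\frac{\partial F_1}{\partial\alpha}=\frac{\partial F_2}{\partial\beta},\qquad \frac{\partial F_1}{\partial\beta}=-\frac{\partial F_2}{\partial\alpha}\qquad(z=\alpha+i\beta\in D),$$ and $f(\alpha+\beta J)=F_1(\alpha+i\beta)+J\,F_2(\alpha+i\beta)$ for all $\alpha+i\beta\in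 D$, $J\in\mathbb{S}$. Its spherical derivative is $f'_s:\Omega\setminus\mathbb{R}\to A$, $f'_s(x)=\frac12\,\mathrm{im}(x)^{-1}\,(f(x)-f(x^c))$ with $\mathrm{im}(x)=\frac12(x-x^c)$, and $V(f'_s)=\{x\in\Omega\setminus\mathbb{R} : f'_s(x)=0\}$. **Open mapping theorem.** Let $f:\Omega\to A$ be slice regular. 1. If $\Omega$ is a slice domain and $f$ is not constant, then the restriction of $f$ to $\Omega\setminus\overline{V(f'_s)}$ is an open map. Moreover, $f(U)$ is open in $A$ for every circular open subset $U\subseteq\Omega$. In particular, $f(\Omega)$ is open. 2. If the fiber $f^{-1}(y_0)$ is discrete for every $y_0\in f(\Omega)$, then $f$ is an open map. (Here $\Omega$ need not be a slice domain.) -/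

import Mathlib

/-- The real vector space `𝕆 = ℍ + ℓℍ` of octonions: the pair `(a, b)` stands for `a + ℓ b`.
It carries the Euclidean norm `‖a + ℓ b‖² = ‖a‖² + ‖b‖²`. -/
def Octonion : Type := WithLp 2 (Quaternion ℝ × Quaternion ℝ)

namespace Octonion

noncomputable instance : NormedAddCommGroup Octonion :=
  inferInstanceAs (NormedAddCommGroup (WithLp 2 (Quaternion ℝ × Quaternion ℝ)))

noncomputable instance : InnerProductSpace ℝ Octonion :=
  inferInstanceAs (InnerProductSpace ℝ (WithLp 2 (Quaternion ℝ × Quaternion ℝ)))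

/-- The octonion `a + ℓ b`. -/
def mk (a b : Quaternion ℝ) : Octonion := WithLp.toLp 2 (a, b)

/-- The component `a` of `a + ℓ b`. -/
def fst (x : Octonion) : Quaternion ℝ := (WithLp.ofLp x).1

/-- The component `b` of `a + ℓ b`. -/
def snd (x : Octonion) : Quaternion ℝ := (WithLp.ofLp x).2

/-- The Cayley-Dickson product `(α + ℓβ)(γ + ℓδ) = αγ - δβᶜ + ℓ(αᶜδ + γβ)`. -/
noncomputable instance : Mul Octonion where
  mul x y := mk (x.fst * y.fst - y.snd * star x.snd) (star x.fst * y.snd + y.fst * x.snd)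

noncomputable instance : One Octonion where
  one := mk 1 0

/-- The conjugation `(α + ℓβ)ᶜ = αᶜ - ℓβ`. -/
noncomputable instance : Star Octonion where
  star x := mk (star x.fst) (-x.snd)

/-- The inverse `x⁻¹ = n(x)⁻¹ xᶜ`, where `n(x) = ‖x‖²`. -/
noncomputable instance : Inv Octonion where
  inv x := (‖x‖ ^ 2)⁻¹ • star x

end Octonion

namespace Slice

/-! The following notions are used for the three real `*`-algebras `A = ℂ, ℍ, 𝕆`. -/

section

variable {A : Type} [NormedAddCommGroup A] [NormedSpace ℝ A] [Mul A] [One A] [Star A] [Inv A]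

variable (A) in
/-- The copy `ℝ · 1` of the real line in `A`. -/
def realLine : Set A := {x | ∃ r : ℝ, x = r • (1 : A)}

variable (A) in
/-- The sphere `𝕊` of imaginary units of `A`. -/
def imaginaryUnits : Set A := {w | w * w = -1}

variable (A) in
/-- The circularization in `A` of a set `E` of complex numbers:
all `α + βJ` with `α + βi ∈ E` and `J ∈ 𝕊`. -/
def circularization (E : Set ℂ) : Set A :=
  {x | ∃ α β : ℝ, ∃ J ∈ imaginaryUnits A, x = α • (1 : A) + β • J ∧ (⟨α, β⟩ : ℂ) ∈ E}

/-- A subset of `A` is circular if it is the circularization of some set of complex numbers. -/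
def IsCircular (S : Set A) : Prop := ∃ E : Set ℂ, S = circularization A E

/-- Invariance of a set of complex numbers under complex conjugation. -/
def ConjInvariant (D : Set ℂ) : Prop := ∀ z ∈ D, star z ∈ D

/-- A slice domain: the circularization of a conjugation-invariant connected open subset of `ℂ`
that intersects the real line. -/
def IsSliceDomain (Ω : Set A) : Prop :=
  ∃ D : Set ℂ, IsOpen D ∧ ConjInvariant D ∧ IsConnected D ∧ (∃ r : ℝ, (r : ℂ) ∈ D) ∧
    Ω = circularization A D

/-- `(F₁, F₂)` are the components of a stem function `F = F₁ + iF₂ : D → A ⊗ ℂ`, that is,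
`F(z̄)` is the conjugate of `F(z)`. -/
def IsStemFunction (D : Set ℂ) (F₁ F₂ : ℂ → A) : Prop :=
  ∀ z ∈ D, F₁ (star z) = F₁ z ∧ F₂ (star z) = -F₂ z

/-- `F = F₁ + iF₂ : D → A ⊗ ℂ` is holomorphic: it is continuously differentiable and
satisfies the Cauchy-Riemann equations `∂F₁/∂α = ∂F₂/∂β`, `∂F₁/∂β = -∂F₂/∂α`,
where `z = α + βi`. -/
def IsHolomorphicPair (D : Set ℂ) (F₁ F₂ : ℂ → A) : Prop :=
  ContDiffOn ℝ 1 F₁ D ∧ ContDiffOn ℝ 1 F₂ D ∧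
    ∀ z ∈ D, fderiv ℝ F₁ z 1 = fderiv ℝ F₂ z Complex.I ∧
      fderiv ℝ F₁ z Complex.I = -fderiv ℝ F₂ z 1

/-- `f` is a slice regular function on `Ω`: the set `Ω` is the circularization of a
conjugation-invariant open subset `D` of `ℂ` (so `Ω` is open and circular), and `f` is induced on
`Ω` by a holomorphic stem function `F₁ + iF₂` on `D`, that is, `f(α + βJ) = F₁(α + βi) + J F₂(α + βi)`
for all `α + βi ∈ D` and `J ∈ 𝕊`. The values of `f` outside `Ω` play no role. -/
def SliceRegularOn (f : A → A) (Ω : Set A) : Prop :=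
  ∃ D : Set ℂ, IsOpen D ∧ ConjInvariant D ∧ Ω = circularization A D ∧
    ∃ F₁ F₂ : ℂ → A, IsStemFunction D F₁ F₂ ∧ IsHolomorphicPair D F₁ F₂ ∧
      ∀ α β : ℝ, (⟨α, β⟩ : ℂ) ∈ D → ∀ J ∈ imaginaryUnits A,
        f (α • (1 : A) + β • J) = F₁ ⟨α, β⟩ + J * F₂ ⟨α, β⟩

/-- The imaginary part `(x - xᶜ) / 2`. -/
noncomputable def imPart (x : A) : A := (1 / 2 : ℝ) • (x - star x)

/-- The spherical derivative `f'ₛ(x) = (1/2) im(x)⁻¹ (f(x) - f(xᶜ))`, meant for `x` not real. -/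
noncomputable def sphericalDerivative (f : A → A) (x : A) : A :=
  (1 / 2 : ℝ) • ((imPart x)⁻¹ * (f x - f (star x)))

/-- The zero set in `Ω \ ℝ` of the spherical derivative `f'ₛ : Ω \ ℝ → A`. -/
def sphericalDerivativeZeros (f : A → A) (Ω : Set A) : Set A :=
  {x | x ∈ Ω \ realLine A ∧ sphericalDerivative f x = 0}

/-- `f` is constant on `Ω`. -/
def IsConstantOn (f : A → A) (Ω : Set A) : Prop := ∃ c : A, ∀ x ∈ Ω, f x = c

end

end Slice

open Filter Topology Set

/-! ### Composition algebras, imaginary units and circular sets. -/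

namespace Slice

/-! The equation `f(α + βJ) = y` says `(F₁ - y) + J F₂ = 0`. In a composition algebra some `J ∈ 𝕊`
solves it exactly when `F₁ - y` and `F₂` are orthogonal of equal norm (`normStem_eq_zero_iff`).
These two real conditions are the vanishing of one complex function `normStem F₁ F₂ y`, holomorphic
in `z` and continuous in `(y, z)`. A zero of it that is not locally identical persists when `y`
moves (`eventually_exists_zero`), so all `y` near `y₀` are values of `f` on spheres close to the
given one.

It remains to control `J`. Nothing is needed on circular sets, or at real points, where the spheres
shrink to a point. Where `F₂ ≠ 0`, `J = (y - F₁) F₂⁻¹` is continuous.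

On a slice domain the normal function vanishes locally only if `f` is constant
(`eq_const_of_normStem_eventually_zero`). Discrete fibers exclude both degenerate cases when `dim A
> 2`. For `ℂ`, where `𝕊 = {±i}` is discrete, the classical theorem is used for discrete fibers.
Associativity is replaced throughout by the laws `star_mul_mul` and `mul_star_mul`. -/

/-- A real algebra, not assumed associative, with a multiplicative Euclidean norm, whose conjugation
and inverse are the ones given by the norm, and which contains an imaginary unit. -/
class NormedCompositionAlgebra (A : Type) [NormedAddCommGroup A] [InnerProductSpace ℝ A]
    [Mul A] [One A] [Star A] [Inv A] : Prop where
  add_mul' : ∀ x y z : A, (x + y) * z = x * z + y * z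
  mul_add' : ∀ x y z : A, x * (y + z) = x * y + x * z
  smul_mul' : ∀ (r : ℝ) (x y : A), (r • x) * y = r • (x * y)
  mul_smul' : ∀ (r : ℝ) (x y : A), x * (r • y) = r • (x * y)
  mul_one' : ∀ x : A, x * 1 = x
  one_mul' : ∀ x : A, 1 * x = x
  norm_mul' : ∀ x y : A, ‖x * y‖ = ‖x‖ * ‖y‖
  norm_one' : ‖(1 : A)‖ = 1
  star_eq : ∀ x : A, star x = (2 * inner ℝ x 1) • (1 : A) - x
  inv_eq : ∀ x : A, x⁻¹ = (‖x‖ ^ 2)⁻¹ • star x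
  star_mul_mul : ∀ x y : A, star x * (x * y) = ‖x‖ ^ 2 • y
  mul_star_mul : ∀ x y : A, (x * star y) * y = ‖y‖ ^ 2 • x
  exists_imaginaryUnit : ∃ J : A, J * J = -1

namespace NormedCompositionAlgebra

variable {A : Type} [NormedAddCommGroup A] [InnerProductSpace ℝ A]
    [Mul A] [One A] [Star A] [Inv A] [NormedCompositionAlgebra A]

variable (A) in
/-- The multiplication of `A` as a bilinear map. -/
noncomputable def mulBilin : A →ₗ[ℝ] A →ₗ[ℝ] A :=
  LinearMap.mk₂ ℝ (· * ·) add_mul' smul_mul' mul_add' mul_smul'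

lemma continuous_mul' : Continuous fun p : A × A => p.1 * p.2 := by
  have h := ((mulBilin A).mkContinuous₂ 1
    (fun x y => by simp [mulBilin, norm_mul'])).continuous₂
  exact h

lemma neg_mul' (x y : A) : -x * y = -(x * y) := by
  simpa using smul_mul' (-1 : ℝ) x y

lemma mul_neg' (x y : A) : x * -y = -(x * y) := by
  simpa using mul_smul' (-1 : ℝ) x y

lemma mul_zero' (x : A) : x * 0 = 0 := by
  simpa using mul_smul' (0 : ℝ) x 0

lemma inv_mul_cancel_left' {x : A} (hx : x ≠ 0) (y : A) : x⁻¹ * (x * y) = y := by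
  rw [inv_eq, smul_mul', star_mul_mul, smul_smul, inv_mul_cancel₀ (by simpa using hx), one_smul]

lemma mul_inv_mul_cancel {y : A} (hy : y ≠ 0) (x : A) : (x * y⁻¹) * y = x := by
  rw [inv_eq, mul_smul', smul_mul', mul_star_mul, smul_smul, inv_mul_cancel₀ (by simpa using hy),
    one_smul]

lemma continuousAt_inv' {x : A} (hx : x ≠ 0) : ContinuousAt (fun x : A => x⁻¹) x := by
  have h : (fun x : A => x⁻¹) = fun x : A =>
      (‖x‖ ^ 2)⁻¹ • ((2 * inner ℝ x 1) • (1 : A) - x) := by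
    ext x; rw [inv_eq, star_eq]
  rw [h]
  have : ‖x‖ ^ 2 ≠ 0 := by simpa using hx
  fun_prop (disch := assumption)

/-- Polarization of the multiplicativity of the norm. -/
lemma inner_mul_right' (x y b : A) : inner ℝ (x * b) (y * b) = inner ℝ x y * ‖b‖ ^ 2 := by
  have h := norm_add_sq_real (x * b) (y * b)
  rw [← add_mul', norm_mul', norm_mul', norm_mul', mul_pow, norm_add_sq_real x y] at h
  linarith

/-- If `J * J = -1`, then `star J * (J * J) = ‖J‖ ^ 2 • J` reads `star J = -J`, so the real part
vanishes. Thus `𝕊` is the unit sphere of the orthogonal complement of `1`. -/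
lemma mem_imaginaryUnits_iff {J : A} :
    J ∈ imaginaryUnits A ↔ ‖J‖ = 1 ∧ inner ℝ J 1 = 0 := by
  constructor
  · intro h
    have h : J * J = -1 := h
    have h1 : ‖J‖ = 1 := by
      have h2 := norm_mul' J J
      rw [h, norm_neg, norm_one'] at h2
      nlinarith [norm_nonneg J]
    refine ⟨h1, ?_⟩
    have h2 := star_mul_mul J J
    rw [h, h1, mul_neg', mul_one', star_eq] at h2
    have h3 : (2 * inner ℝ J 1) • (1 : A) = 0 := by
      simpa using h2
    have h4 : ‖(2 * inner ℝ J 1) • (1 : A)‖ = 0 := by rw [h3, norm_zero]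
    rw [norm_smul, norm_one'] at h4
    simpa using h4
  · rintro ⟨h1, h2⟩
    have h3 := star_mul_mul J 1
    rw [h1, star_eq, h2, mul_one'] at h3
    have h4 : -(J * J) = 1 := by simpa [neg_mul'] using h3
    change J * J = -1
    rw [← h4, neg_neg]

lemma neg_mem_imaginaryUnits {J : A} (hJ : J ∈ imaginaryUnits A) : -J ∈ imaginaryUnits A := by
  rw [mem_imaginaryUnits_iff] at *
  simpa using hJ

lemma imaginaryUnits_nonempty : (imaginaryUnits A).Nonempty := exists_imaginaryUnit

/-- The point `α + i‖im x‖` of the closed upper half plane, for `x` with real part `α`. -/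
noncomputable def complexCoord (x : A) : ℂ := ⟨inner ℝ x 1, ‖x - (inner ℝ x 1 : ℝ) • (1 : A)‖⟩

omit [Mul A] [Star A] [Inv A] [NormedCompositionAlgebra A] in
lemma continuous_complexCoord : Continuous (complexCoord : A → ℂ) := by
  have h : (complexCoord : A → ℂ) = fun x =>
      ((inner ℝ x 1 : ℝ) : ℂ) + (‖x - (inner ℝ x 1 : ℝ) • (1 : A)‖ : ℝ) * Complex.I := by
    ext x
    exact Complex.mk_eq_add_mul_I _ _
  rw [h]
  fun_prop

lemma inner_add_smul_one (α β : ℝ) {J : A} (hJ : J ∈ imaginaryUnits A) :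
    inner ℝ (α • (1 : A) + β • J) 1 = α := by
  simp [inner_add_left, real_inner_smul_left, norm_one', (mem_imaginaryUnits_iff.1 hJ).2]

lemma complexCoord_add_smul (α β : ℝ) {J : A} (hJ : J ∈ imaginaryUnits A) :
    complexCoord (α • (1 : A) + β • J) = ⟨α, |β|⟩ := by
  simp [complexCoord, inner_add_smul_one α β hJ, norm_smul, (mem_imaginaryUnits_iff.1 hJ).1]

lemma exists_eq_add_smul (x : A) : ∃ J ∈ imaginaryUnits A,
    x = (complexCoord x).re • (1 : A) + (complexCoord x).im • J := by
  by_cases h : x - (inner ℝ x 1 : ℝ) • (1 : A) = 0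
  · obtain ⟨J, hJ⟩ := imaginaryUnits_nonempty (A := A)
    refine ⟨J, hJ, ?_⟩
    simp only [complexCoord, h, norm_zero, zero_smul, add_zero]
    exact sub_eq_zero.1 h
  · refine ⟨‖x - (inner ℝ x 1 : ℝ) • (1 : A)‖⁻¹ • (x - (inner ℝ x 1 : ℝ) • (1 : A)), ?_, ?_⟩
    · rw [mem_imaginaryUnits_iff]
      refine ⟨by rw [norm_smul, norm_inv, norm_norm, inv_mul_cancel₀ (norm_ne_zero_iff.2 h)], ?_⟩
      simp [real_inner_smul_left, inner_sub_left, norm_one']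
    · simp only [complexCoord]
      rw [smul_smul, mul_inv_cancel₀ (norm_ne_zero_iff.2 h), one_smul]
      abel

lemma mk_abs_mem_iff {D : Set ℂ} (hD : ConjInvariant D) (α β : ℝ) :
    (⟨α, |β|⟩ : ℂ) ∈ D ↔ (⟨α, β⟩ : ℂ) ∈ D := by
  rcases abs_choice β with h | h
  · rw [h]
  · rw [h]
    constructor
    · intro h'
      have := hD _ h'
      rwa [show star (⟨α, -β⟩ : ℂ) = ⟨α, β⟩ from Complex.ext rfl (neg_neg β)] at this
    · intro h'
      exact hD _ h'

lemma mem_circularization_iff {D : Set ℂ} (hD : ConjInvariant D) {x : A} :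
    x ∈ circularization A D ↔ complexCoord x ∈ D := by
  constructor
  · rintro ⟨α, β, J, hJ, rfl, h⟩
    rw [complexCoord_add_smul α β hJ]
    exact (mk_abs_mem_iff hD α β).2 h
  · intro h
    obtain ⟨J, hJ, hx⟩ := exists_eq_add_smul x
    exact ⟨_, _, J, hJ, hx, h⟩

lemma add_smul_mem_circularization_iff {D : Set ℂ} (hD : ConjInvariant D) {α β : ℝ} {J : A}
    (hJ : J ∈ imaginaryUnits A) :
    α • (1 : A) + β • J ∈ circularization A D ↔ (⟨α, β⟩ : ℂ) ∈ D := by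
  rw [mem_circularization_iff hD, complexCoord_add_smul α β hJ, mk_abs_mem_iff hD]

lemma isOpen_circularization {D : Set ℂ} (hD : ConjInvariant D) (hDo : IsOpen D) :
    IsOpen (circularization A D) := by
  have : circularization A D = complexCoord ⁻¹' D := by
    ext x
    exact mem_circularization_iff hD
  rw [this]
  exact hDo.preimage continuous_complexCoord

/-- Identifies the set `D` supplied by slice regularity with the one supplied by the slice domain
condition. -/
lemma circularization_injective {D D' : Set ℂ} (hD : ConjInvariant D) (hD' : ConjInvariant D')
    (h : circularization A D = circularization A D') : D = D' := by
  obtain ⟨J, hJ⟩ := imaginaryUnits_nonempty (A := A)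
  ext ⟨α, β⟩
  rw [← add_smul_mem_circularization_iff hD hJ, h, add_smul_mem_circularization_iff hD' hJ]

/-- `a + J b = 0` has a solution `J ∈ 𝕊` if and only if `a` and `b` are orthogonal of equal norm. -/
lemma exists_imaginaryUnit_mul_eq_iff {a b : A} :
    (∃ J ∈ imaginaryUnits A, a + J * b = 0) ↔ ‖a‖ = ‖b‖ ∧ inner ℝ a b = 0 := by
  constructor
  · rintro ⟨J, hJ, h⟩
    rw [mem_imaginaryUnits_iff] at hJ
    rw [eq_neg_of_add_eq_zero_left h]
    have h2 := inner_mul_right' J 1 b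
    rw [one_mul', hJ.2, zero_mul] at h2
    simp [norm_mul', hJ.1, h2]
  · rintro ⟨h1, h2⟩
    by_cases hb : b = 0
    · obtain ⟨J, hJ⟩ := imaginaryUnits_nonempty (A := A)
      refine ⟨J, hJ, ?_⟩
      subst hb
      rw [mul_zero', add_zero, ← norm_eq_zero, h1, norm_zero]
    · have hb' : ‖b‖ ≠ 0 := norm_ne_zero_iff.2 hb
      -- The only candidate for `J`; its norm and real part are read off after multiplying by `b` on
      -- the right.
      refine ⟨-(a * b⁻¹), neg_mem_imaginaryUnits (mem_imaginaryUnits_iff.2 ⟨?_, ?_⟩), ?_⟩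
      · have := norm_mul' (a * b⁻¹) b
        rw [mul_inv_mul_cancel hb, h1] at this
        exact (mul_right_cancel₀ hb' (by rw [one_mul, ← this]))
      · have := inner_mul_right' (a * b⁻¹) 1 b
        rw [mul_inv_mul_cancel hb, one_mul', h2] at this
        exact (mul_eq_zero.1 this.symm).resolve_right (pow_ne_zero 2 hb')
      · rw [neg_mul', mul_inv_mul_cancel hb, add_neg_cancel]

lemma mul_right_cancel' {x y b : A} (hb : b ≠ 0) (h : x * b = y * b) : x = y := by
  have h1 : (x - y) * b = 0 := by rw [sub_eq_add_neg, add_mul', neg_mul', h, add_neg_cancel]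
  have h2 := norm_mul' (x - y) b
  rw [h1, norm_zero] at h2
  exact sub_eq_zero.1
    (norm_eq_zero.1 ((mul_eq_zero.1 h2.symm).resolve_right (norm_ne_zero_iff.2 hb)))

/-- Every imaginary unit is a limit of other imaginary units when `A` has dimension at least `3`. -/
lemma exists_tendsto_imaginaryUnits (hA : 2 < Module.finrank ℝ A) {J : A}
    (hJ : J ∈ imaginaryUnits A) : ∃ K : ℝ → A, Tendsto K (𝓝[>] 0) (𝓝 J) ∧
      ∀ᶠ t in 𝓝[>] 0, K t ∈ imaginaryUnits A ∧ K t ≠ J := by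
  have : FiniteDimensional ℝ A := Module.finite_of_finrank_pos (by omega)
  rw [mem_imaginaryUnits_iff] at hJ
  classical
  have h1 : Module.finrank ℝ (Submodule.span ℝ (({1, J} : Finset A) : Set A)) ≤ 2 :=
    (finrank_span_finset_le_card _).trans Finset.card_le_two
  have h2 := (Submodule.span ℝ (({1, J} : Finset A) : Set A)).finrank_add_finrank_orthogonal
  -- A direction orthogonal to both `1` and `J`, towards which `J` is then rotated along a great
  -- circle of `𝕊`.
  obtain ⟨L, hL, hL0⟩ := (Submodule.ne_bot_iff _).1 (show
    (Submodule.span ℝ (({1, J} : Finset A) : Set A))ᗮ ≠ ⊥ by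
      intro h
      rw [h, finrank_bot] at h2
      omega)
  have hL1 : inner ℝ L 1 = 0 := Submodule.inner_left_of_mem_orthogonal
    (Submodule.subset_span (by simp)) hL
  have hLJ : inner ℝ L J = 0 := Submodule.inner_left_of_mem_orthogonal
    (Submodule.subset_span (by simp)) hL
  set M : A := ‖L‖⁻¹ • L with hM
  have hMn : ‖M‖ = 1 := by
    rw [hM, norm_smul, norm_inv, norm_norm, inv_mul_cancel₀ (norm_ne_zero_iff.2 hL0)]
  have hM1 : inner ℝ M 1 = 0 := by rw [hM, real_inner_smul_left, hL1, mul_zero]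
  have hMJ : inner ℝ M J = 0 := by rw [hM, real_inner_smul_left, hLJ, mul_zero]
  refine ⟨fun t => Real.cos t • J + Real.sin t • M, ?_, ?_⟩
  · have : Continuous fun t => Real.cos t • J + Real.sin t • M := by fun_prop
    simpa using (this.tendsto 0).mono_left nhdsWithin_le_nhds
  · filter_upwards [Ioo_mem_nhdsGT Real.pi_pos] with t ht
    refine ⟨mem_imaginaryUnits_iff.2 ⟨?_, ?_⟩, fun h => ?_⟩
    · have : ‖Real.cos t • J + Real.sin t • M‖ ^ 2 = 1 := by
        rw [norm_add_sq_real, real_inner_smul_left, real_inner_smul_right, real_inner_comm, hMJ,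
          norm_smul, norm_smul, hJ.1, hMn]
        simp
      exact (pow_eq_one_iff_of_nonneg (norm_nonneg _) two_ne_zero).1 this
    · simp [inner_add_left, real_inner_smul_left, hM1, hJ.2]
    · have h3 := congrArg (fun x => inner ℝ M x) h
      simp only [inner_add_right, real_inner_smul_right, hMJ, real_inner_self_eq_norm_sq, hMn] at h3
      have := Real.sin_pos_of_pos_of_lt_pi ht.1 ht.2
      simp at h3
      linarith

end NormedCompositionAlgebra


/-! ### Complex analysis: persistence of zeros. -/

/-- The Cauchy-Riemann equations for real and imaginary part imply complex differentiability. -/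
lemma differentiableAt_mk_of_cauchyRiemann {u v : ℂ → ℝ} {z : ℂ}
    (hu : DifferentiableAt ℝ u z) (hv : DifferentiableAt ℝ v z)
    (h1 : fderiv ℝ u z 1 = fderiv ℝ v z Complex.I)
    (hI : fderiv ℝ u z Complex.I = -fderiv ℝ v z 1) :
    DifferentiableAt ℂ (fun w => (⟨u w, v w⟩ : ℂ)) z := by
  have h : HasFDerivAt (fun w => (⟨u w, v w⟩ : ℂ))
      (Complex.equivRealProdCLM.symm.toContinuousLinearMap.comp
        ((fderiv ℝ u z).prod (fderiv ℝ v z))) z :=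
    Complex.equivRealProdCLM.symm.toContinuousLinearMap.hasFDerivAt.comp z
      (hu.hasFDerivAt.prodMk hv.hasFDerivAt)
  rw [differentiableAt_complex_iff_differentiableAt_real]
  refine ⟨h.differentiableAt, ?_⟩
  rw [h.fderiv]
  apply Complex.ext <;> simp [h1, hI]

/-- A zero of a holomorphic function which does not vanish identically near it persists under
continuous perturbations of the function. -/
lemma eventually_exists_zero {Y : Type*} [TopologicalSpace Y] {N : Y → ℂ → ℂ} {D : Set ℂ}
    (hD : IsOpen D) (hN : ∀ y, DifferentiableOn ℂ (N y) D)
    (hc : ∀ y, ∀ z ∈ D, ContinuousAt (fun p : Y × ℂ => N p.1 p.2) (y, z)) {y₀ : Y} {z₀ : ℂ}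
    (hz₀ : z₀ ∈ D) (h0 : N y₀ z₀ = 0) (hne : ¬ ∀ᶠ z in 𝓝 z₀, N y₀ z = 0) {W : Set ℂ}
    (hW : W ∈ 𝓝 z₀) : ∀ᶠ y in 𝓝 y₀, ∃ z ∈ W ∩ D, N y z = 0 := by
  have han : AnalyticAt ℂ (N y₀) z₀ := (hN y₀).analyticAt (hD.mem_nhds hz₀)
  have h1 := han.eventually_eq_zero_or_eventually_ne_zero.resolve_left hne
  rw [eventually_nhdsWithin_iff] at h1
  obtain ⟨r, hr, hr'⟩ := Metric.nhds_basis_closedBall.mem_iff.1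
    (inter_mem h1 (inter_mem hW (hD.mem_nhds hz₀)))
  have hsph : ∀ z ∈ Metric.sphere z₀ r, N y₀ z ≠ 0 := fun z hz =>
    (hr' (Metric.sphere_subset_closedBall hz)).1 (ne_of_mem_of_not_mem hz (by simp [hr.ne]))
  have hball : Metric.closedBall z₀ r ⊆ D := fun z hz => (hr' hz).2.2
  obtain ⟨ε, hε, hεs⟩ : ∃ ε > 0, ∀ z ∈ Metric.sphere z₀ r, ε < ‖N y₀ z‖ := by
    have hcont : ContinuousOn (fun z => ‖N y₀ z‖) (Metric.sphere z₀ r) :=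
      ((hN y₀).continuousOn.mono (Metric.sphere_subset_closedBall.trans hball)).norm
    obtain ⟨x, hx, hmin⟩ := (isCompact_sphere z₀ r).exists_isMinOn
      (NormedSpace.sphere_nonempty.mpr hr.le) hcont
    have hx0 := norm_pos_iff.2 (hsph x hx)
    exact ⟨‖N y₀ x‖ / 2, half_pos hx0, fun z hz => (half_lt_self hx0).trans_le (hmin hz)⟩
  have h2 : ∀ᶠ y in 𝓝 y₀, ∀ z ∈ Metric.sphere z₀ r, ε < ‖N y z‖ :=
    (isCompact_sphere z₀ r).eventually_forall_of_forall_eventually fun z hz =>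
      (hc y₀ z (hball (Metric.sphere_subset_closedBall hz))).norm.eventually_const_lt (hεs z hz)
  have h3 : ∀ᶠ y in 𝓝 y₀, ‖N y z₀‖ < ε := by
    have h4 : ContinuousAt (fun y => ‖N y z₀‖) y₀ :=
      ((hc y₀ z₀ hz₀).comp (f := fun y => (y, z₀)) (by fun_prop)).norm
    exact h4.eventually_lt_const (by simpa [h0] using hε)
  filter_upwards [h2, h3] with y hy2 hy3
  -- Without a zero in the closed ball, the maximum principle for `1 / N y` bounds it at the center
  -- by `ε⁻¹`, contradicting `‖N y z₀‖ < ε`.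
  by_contra! hcon
  have hnz : ∀ z ∈ Metric.closedBall z₀ r, N y z ≠ 0 := fun z hz => hcon z (hr' hz).2
  have hd : DiffContOnCl ℂ (fun z => (N y z)⁻¹) (Metric.ball z₀ r) := by
    apply DifferentiableOn.diffContOnCl
    rw [closure_ball z₀ hr.ne']
    exact ((hN y).mono hball).inv hnz
  have h5 := Complex.norm_le_of_forall_mem_frontier_norm_le Metric.isBounded_ball hd (C := ε⁻¹)
    (fun z hz => by
      rw [frontier_ball z₀ hr.ne'] at hz
      rw [norm_inv]
      exact inv_anti₀ hε (hy2 z hz).le) (subset_closure (Metric.mem_ball_self hr))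
  rw [norm_inv] at h5
  have h6 := norm_pos_iff.2 (hnz z₀ (Metric.mem_closedBall_self hr.le))
  exact absurd ((inv_le_inv₀ h6 hε).1 h5) (not_le.2 hy3)

namespace NormedCompositionAlgebra

/-! ### The normal function of `f - y` and its identity principle. -/

section Stem

variable {A : Type} [NormedAddCommGroup A] [InnerProductSpace ℝ A]

/-- The complexified norm form of `F₁ - y + iF₂`, that is, the stem function of the normal function
of `f - y`. -/
noncomputable def normStem (F₁ F₂ : ℂ → A) (y : A) (z : ℂ) : ℂ :=
  ⟨‖F₁ z - y‖ ^ 2 - ‖F₂ z‖ ^ 2, 2 * inner ℝ (F₁ z - y) (F₂ z)⟩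

variable {D : Set ℂ} {F₁ F₂ : ℂ → A}

lemma IsHolomorphicPair.differentiableAt (hD : IsOpen D) (h : IsHolomorphicPair D F₁ F₂) {z : ℂ}
    (hz : z ∈ D) : DifferentiableAt ℝ F₁ z ∧ DifferentiableAt ℝ F₂ z :=
  ⟨(h.1.contDiffAt (hD.mem_nhds hz)).differentiableAt one_ne_zero,
    (h.2.1.contDiffAt (hD.mem_nhds hz)).differentiableAt one_ne_zero⟩

lemma normStem_eq_inner (y : A) : normStem F₁ F₂ y = fun z =>
    ⟨inner ℝ (F₁ z - y) (F₁ z - y) - inner ℝ (F₂ z) (F₂ z),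
      inner ℝ (F₁ z - y) (F₂ z) + inner ℝ (F₁ z - y) (F₂ z)⟩ := by
  ext z
  simp only [normStem, real_inner_self_eq_norm_sq, two_mul]

/-- The function is the complex bilinear extension of the inner product, evaluated twice at the
holomorphic map `F₁ - y + iF₂`; the product rule carries over the Cauchy-Riemann equations. -/
lemma differentiableOn_normStem (hD : IsOpen D) (h : IsHolomorphicPair D F₁ F₂) (y : A) :
    DifferentiableOn ℂ (normStem F₁ F₂ y) D := by
  intro z hz
  obtain ⟨h1, h2⟩ := IsHolomorphicPair.differentiableAt hD h hz
  have h1' : DifferentiableAt ℝ (fun z => F₁ z - y) z := h1.sub_const y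
  have hcr := h.2.2 z hz
  apply DifferentiableAt.differentiableWithinAt
  rw [normStem_eq_inner]
  have ha := h1'.inner ℝ h1'
  have hb := h2.inner ℝ h2
  have hab := h1'.inner ℝ h2
  apply differentiableAt_mk_of_cauchyRiemann (ha.fun_sub hb) (hab.fun_add hab)
  · rw [fderiv_fun_sub ha hb, fderiv_fun_add hab hab]
    simp only [sub_apply, add_apply,
      fderiv_inner_apply ℝ h1' h1', fderiv_inner_apply ℝ h2 h2, fderiv_inner_apply ℝ h1' h2,
      fderiv_sub_const, hcr.1, hcr.2, inner_neg_left]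
    rw [real_inner_comm (F₁ z - y) (fderiv ℝ F₂ z Complex.I), real_inner_comm (F₂ z)]
    ring
  · rw [fderiv_fun_sub ha hb, fderiv_fun_add hab hab]
    simp only [sub_apply, add_apply,
      fderiv_inner_apply ℝ h1' h1', fderiv_inner_apply ℝ h2 h2, fderiv_inner_apply ℝ h1' h2,
      fderiv_sub_const, hcr.1, hcr.2, inner_neg_left, inner_neg_right]
    rw [real_inner_comm (F₁ z - y), real_inner_comm (F₂ z) (fderiv ℝ F₂ z Complex.I)]
    ring

/-- Scalar components of `F - y`, to which the identity theorem for complex functions applies. -/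
lemma differentiableOn_pairing (hD : IsOpen D) (h : IsHolomorphicPair D F₁ F₂) (y w : A) :
    DifferentiableOn ℂ (fun z => (⟨inner ℝ (F₁ z - y) w, inner ℝ (F₂ z) w⟩ : ℂ)) D := by
  intro z hz
  obtain ⟨h1, h2⟩ := IsHolomorphicPair.differentiableAt hD h hz
  have h1' : DifferentiableAt ℝ (fun z => F₁ z - y) z := h1.sub_const y
  have hcr := h.2.2 z hz
  apply DifferentiableAt.differentiableWithinAt
  have hw : DifferentiableAt ℝ (fun _ : ℂ => w) z := differentiableAt_const w
  apply differentiableAt_mk_of_cauchyRiemann (h1'.inner ℝ hw) (h2.inner ℝ hw)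
  · rw [fderiv_inner_apply ℝ h1' hw, fderiv_inner_apply ℝ h2 hw]
    simp [fderiv_sub_const, hcr.1]
  · rw [fderiv_inner_apply ℝ h1' hw, fderiv_inner_apply ℝ h2 hw]
    simp [fderiv_sub_const, hcr.2]

lemma continuousAt_normStem (hD : IsOpen D) (h : IsHolomorphicPair D F₁ F₂) (y : A) {z : ℂ}
    (hz : z ∈ D) : ContinuousAt (fun p : A × ℂ => normStem F₁ F₂ p.1 p.2) (y, z) := by
  obtain ⟨h1, h2⟩ := IsHolomorphicPair.differentiableAt hD h hz
  have c1 : ContinuousAt (fun p : A × ℂ => F₁ p.2) (y, z) :=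
    h1.continuousAt.comp (f := fun p : A × ℂ => p.2) continuousAt_snd
  have c2 : ContinuousAt (fun p : A × ℂ => F₂ p.2) (y, z) :=
    h2.continuousAt.comp (f := fun p : A × ℂ => p.2) continuousAt_snd
  have h3 : (fun p : A × ℂ => normStem F₁ F₂ p.1 p.2) = fun p =>
      ((‖F₁ p.2 - p.1‖ ^ 2 - ‖F₂ p.2‖ ^ 2 : ℝ) : ℂ)
        + ((2 * inner ℝ (F₁ p.2 - p.1) (F₂ p.2) : ℝ) : ℂ) * Complex.I := by
    ext p
    exact Complex.mk_eq_add_mul_I _ _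
  rw [h3]
  have c3 : ContinuousAt (fun p : A × ℂ => F₁ p.2 - p.1) (y, z) := c1.sub continuousAt_fst
  have c4 := c3.inner (𝕜 := ℝ) c2
  exact (Complex.continuous_ofReal.continuousAt.comp ((c3.norm.pow 2).sub (c2.norm.pow 2))).add
    ((Complex.continuous_ofReal.continuousAt.comp (c4.const_mul 2)).mul continuousAt_const)

lemma IsStemFunction.snd_ofReal (h : IsStemFunction D F₁ F₂) {r : ℝ} (hr : (r : ℂ) ∈ D) :
    F₂ r = 0 := by
  have h1 := (h r hr).2
  rw [show star (r : ℂ) = r from Complex.conj_ofReal r] at h1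
  have h2 : (2 : ℝ) • F₂ r = 0 := by
    rw [two_smul]
    nth_rewrite 1 [h1]
    exact neg_add_cancel _
  exact (smul_eq_zero.1 h2).resolve_left two_ne_zero

lemma fst_eq_of_normStem_eq_zero (h : IsStemFunction D F₁ F₂) {r : ℝ} (hr : (r : ℂ) ∈ D) {y : A}
    (h0 : normStem F₁ F₂ y r = 0) : F₁ r = y := by
  have h1 := congrArg Complex.re h0
  simp only [normStem, IsStemFunction.snd_ofReal h hr] at h1
  simpa [sub_eq_zero] using h1

lemma frequently_of_real {P : ℂ → Prop} {r : ℝ} (h : ∀ᶠ s : ℝ in 𝓝 r, P s) :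
    ∃ᶠ z in 𝓝[≠] (r : ℂ), P z := by
  have h1 : Tendsto (fun s : ℝ => (s : ℂ)) (𝓝[≠] r) (𝓝[≠] (r : ℂ)) :=
    tendsto_nhdsWithin_iff.2 ⟨(Complex.continuous_ofReal.tendsto r).mono_left nhdsWithin_le_nhds,
      by filter_upwards [self_mem_nhdsWithin] with s hs; simpa using hs⟩
  exact h1.frequently (h.filter_mono nhdsWithin_le_nhds).frequently

/-- On a connected domain that meets the real line, the normal function of `f - y` vanishes near a
point only if `f` is constantly equal to `y`. -/
lemma eq_const_of_normStem_eventually_zero (hD : IsOpen D) (hc : IsPreconnected D) {r : ℝ}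
    (hr : (r : ℂ) ∈ D) (hs : IsStemFunction D F₁ F₂) (h : IsHolomorphicPair D F₁ F₂) {y : A}
    {z₀ : ℂ} (hz₀ : z₀ ∈ D) (h0 : ∀ᶠ z in 𝓝 z₀, normStem F₁ F₂ y z = 0) :
    ∀ z ∈ D, F₁ z = y ∧ F₂ z = 0 := by
  have h1 := ((differentiableOn_normStem hD h y).analyticOnNhd
    hD).eqOn_zero_of_preconnected_of_eventuallyEq_zero hc hz₀ h0
  have hev : ∀ᶠ s : ℝ in 𝓝 r, (s : ℂ) ∈ D :=
    (Complex.continuous_ofReal.tendsto r).eventually (hD.mem_nhds hr)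
  -- The complexified norm form has isotropic vectors, so its vanishing does not give `F = y`
  -- pointwise. At real points it does, since `F₂ = 0` there; the identity theorem spreads this to
  -- `D`.
  have h2 : ∀ w : A, ∀ z ∈ D, inner ℝ (F₁ z - y) w = 0 ∧ inner ℝ (F₂ z) w = 0 := by
    intro w z hz
    have h3 := ((differentiableOn_pairing hD h y w).analyticOnNhd
      hD).eqOn_zero_of_preconnected_of_frequently_eq_zero hc hr (frequently_of_real (by
        filter_upwards [hev] with s hs'
        rw [fst_eq_of_normStem_eq_zero hs hs' (h1 hs'), IsStemFunction.snd_ofReal hs hs']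
        simp only [sub_self, inner_zero_left]
        rfl)) hz
    exact ⟨congrArg Complex.re h3, congrArg Complex.im h3⟩
  intro z hz
  exact ⟨sub_eq_zero.1 (inner_self_eq_zero.1 (h2 _ z hz).1), inner_self_eq_zero.1 (h2 _ z hz).2⟩

end Stem

end NormedCompositionAlgebra


/-! ### Local openness. -/

lemma isOpenMap_domRestrict {X Y : Type*} [TopologicalSpace X] [TopologicalSpace Y] {f : X → Y}
    {S : Set X} (hS : IsOpen S) (h : ∀ x ∈ S, ∀ W ∈ 𝓝 x, f '' W ∈ 𝓝 (f x)) :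
    IsOpenMap (S.domRestrict f) := by
  intro V hV
  have h1 : S.domRestrict f '' V = f '' (Subtype.val '' V) := by
    rw [image_image]
    rfl
  rw [h1, isOpen_iff_mem_nhds]
  rintro _ ⟨x, hx, rfl⟩
  have hx' : x ∈ S := by
    obtain ⟨x, -, rfl⟩ := hx
    exact x.2
  exact h x hx' _ ((hS.isOpenMap_subtype_val V hV).mem_nhds hx)

namespace NormedCompositionAlgebra

variable {A : Type} [NormedAddCommGroup A] [InnerProductSpace ℝ A]
    [Mul A] [One A] [Star A] [Inv A] [NormedCompositionAlgebra A]
    {D : Set ℂ} {F₁ F₂ : ℂ → A} {f : A → A}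

/-- Real and imaginary part of `normStem` encode equality of norms and orthogonality in
`exists_imaginaryUnit_mul_eq_iff`, for `a = F₁ z - y` and `b = F₂ z`. -/
lemma normStem_eq_zero_iff {y : A} {z : ℂ} :
    normStem F₁ F₂ y z = 0 ↔ ∃ J ∈ imaginaryUnits A, F₁ z + J * F₂ z = y := by
  have h1 : ∀ J : A, F₁ z + J * F₂ z = y ↔ (F₁ z - y) + J * F₂ z = 0 := fun J => by
    rw [← sub_eq_zero, add_sub_right_comm]
  simp_rw [h1, exists_imaginaryUnit_mul_eq_iff, Complex.ext_iff, normStem]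
  simp [sub_eq_zero]

/-- If `f` maps a whole circular neighborhood of a sphere into a set, then this set is a neighborhood
of every value on the sphere, unless a normal function vanishes identically. -/
lemma image_mem_nhds_of_forall_imaginaryUnits (hD : IsOpen D) (h : IsHolomorphicPair D F₁ F₂)
    (hf : ∀ α β : ℝ, (⟨α, β⟩ : ℂ) ∈ D → ∀ J ∈ imaginaryUnits A,
      f (α • (1 : A) + β • J) = F₁ ⟨α, β⟩ + J * F₂ ⟨α, β⟩)
    {z₀ : ℂ} (hz₀ : z₀ ∈ D) {y₀ J₀ : A} (hJ₀ : J₀ ∈ imaginaryUnits A)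
    (hy₀ : F₁ z₀ + J₀ * F₂ z₀ = y₀)
    (hne : ¬ ∀ᶠ z in 𝓝 z₀, normStem F₁ F₂ y₀ z = 0) {W : Set A}
    (hW : ∀ᶠ z in 𝓝 z₀, ∀ J ∈ imaginaryUnits A, z.re • (1 : A) + z.im • J ∈ W) :
    f '' W ∈ 𝓝 y₀ := by
  filter_upwards [eventually_exists_zero hD (differentiableOn_normStem hD h)
    (fun y z hz => continuousAt_normStem hD h y hz) hz₀
    (normStem_eq_zero_iff.2 ⟨J₀, hJ₀, hy₀⟩) hne hW]
  rintro y ⟨z, ⟨hzW, hzD⟩, hz⟩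
  obtain ⟨J, hJ, hy⟩ := normStem_eq_zero_iff.1 hz
  exact ⟨_, hzW J hJ, (hf _ _ hzD J hJ).trans hy⟩

/-- Where `F₂` does not vanish, the solution `J` of `F₁(z) + J F₂(z) = y` depends continuously on
`(y, z)`. -/
lemma eventually_add_smul_mem (hD : IsOpen D) (h : IsHolomorphicPair D F₁ F₂) {z₀ : ℂ}
    (hz₀ : z₀ ∈ D) {y₀ J₀ : A} (hy₀ : F₁ z₀ + J₀ * F₂ z₀ = y₀) (h2 : F₂ z₀ ≠ 0) {W : Set A}
    (hW : W ∈ 𝓝 (z₀.re • (1 : A) + z₀.im • J₀)) :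
    ∀ᶠ p in 𝓝 y₀ ×ˢ 𝓝 z₀, ∀ J : A, F₁ p.2 + J * F₂ p.2 = p.1 →
      p.2.re • (1 : A) + p.2.im • J ∈ W := by
  obtain ⟨c1, c2⟩ := IsHolomorphicPair.differentiableAt hD h hz₀
  have c2' : ContinuousAt (fun p : A × ℂ => F₂ p.2) (y₀, z₀) :=
    c2.continuousAt.comp (f := fun p : A × ℂ => p.2) continuousAt_snd
  have hcJ : ContinuousAt (fun p : A × ℂ => (p.1 - F₁ p.2) * (F₂ p.2)⁻¹) (y₀, z₀) := by
    have c1' : ContinuousAt (fun p : A × ℂ => F₁ p.2) (y₀, z₀) :=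
      c1.continuousAt.comp (f := fun p : A × ℂ => p.2) continuousAt_snd
    exact continuous_mul'.continuousAt.comp
      (f := fun p : A × ℂ => (p.1 - F₁ p.2, (F₂ p.2)⁻¹)) ((continuousAt_fst.sub c1').prodMk
        ((continuousAt_inv' h2).comp (f := fun p : A × ℂ => F₂ p.2) c2'))
  have hsolve : ∀ {y J : A} {z : ℂ}, F₂ z ≠ 0 → F₁ z + J * F₂ z = y →
      (y - F₁ z) * (F₂ z)⁻¹ = J := fun hz hy => mul_right_cancel' hz (by
    rw [mul_inv_mul_cancel hz, ← hy, add_sub_cancel_left])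
  have hcx : ContinuousAt (fun p : A × ℂ => p.2.re • (1 : A) +
      p.2.im • ((p.1 - F₁ p.2) * (F₂ p.2)⁻¹)) (y₀, z₀) :=
    ((Complex.continuous_re.comp continuous_snd).continuousAt.smul continuousAt_const).add
      ((Complex.continuous_im.comp continuous_snd).continuousAt.smul hcJ)
  have hWev := hcx.eventually (show ∀ᶠ x in 𝓝 _, x ∈ W by
    beta_reduce
    rwa [hsolve h2 hy₀])
  rw [← nhds_prod_eq]
  filter_upwards [hWev, c2'.eventually_ne h2] with p hp hp2 J hJ
  rwa [hsolve hp2 hJ] at hp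

/-- The zero that persists lies near `z₀`, and `eventually_add_smul_mem` then keeps the
corresponding point `α + βJ` in `W`. -/
lemma image_mem_nhds_of_snd_ne_zero (hD : IsOpen D) (h : IsHolomorphicPair D F₁ F₂)
    (hf : ∀ α β : ℝ, (⟨α, β⟩ : ℂ) ∈ D → ∀ J ∈ imaginaryUnits A,
      f (α • (1 : A) + β • J) = F₁ ⟨α, β⟩ + J * F₂ ⟨α, β⟩)
    {z₀ : ℂ} (hz₀ : z₀ ∈ D) {y₀ J₀ : A} (hJ₀ : J₀ ∈ imaginaryUnits A)
    (hy₀ : F₁ z₀ + J₀ * F₂ z₀ = y₀) (h2 : F₂ z₀ ≠ 0)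
    (hne : ¬ ∀ᶠ z in 𝓝 z₀, normStem F₁ F₂ y₀ z = 0) {W : Set A}
    (hW : W ∈ 𝓝 (z₀.re • (1 : A) + z₀.im • J₀)) : f '' W ∈ 𝓝 y₀ := by
  obtain ⟨P, hP, Q, hQ, hPQ⟩ :=
    eventually_prod_iff.1 (eventually_add_smul_mem hD h hz₀ hy₀ h2 hW)
  filter_upwards [hP, eventually_exists_zero hD (differentiableOn_normStem hD h)
    (fun y z hz => continuousAt_normStem hD h y hz) hz₀
    (normStem_eq_zero_iff.2 ⟨J₀, hJ₀, hy₀⟩) hne hQ]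
  rintro y hyP ⟨z, ⟨hzQ, hzD⟩, hz⟩
  obtain ⟨J, hJ, hy⟩ := normStem_eq_zero_iff.1 hz
  exact ⟨_, hPQ hyP hzQ J hy, (hf _ _ hzD J hJ).trans hy⟩

/-- The sphere over `z` has radius `|im z|`, which tends to zero at a real point. -/
lemma eventually_forall_mem_of_real {r : ℝ} {W : Set A} (hW : W ∈ 𝓝 (r • (1 : A))) :
    ∀ᶠ z in 𝓝 (r : ℂ), ∀ J ∈ imaginaryUnits A, z.re • (1 : A) + z.im • J ∈ W := by
  obtain ⟨ε, hε, hb⟩ := Metric.mem_nhds_iff.1 hW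
  have hc : Continuous fun z : ℂ => |z.re - r| + |z.im| := by fun_prop
  filter_upwards [(hc.tendsto (r : ℂ)).eventually_lt_const (by simpa using hε)]
    with z hz J hJ
  apply hb
  rw [Metric.mem_ball, dist_eq_norm]
  calc ‖z.re • (1 : A) + z.im • J - r • (1 : A)‖ = ‖(z.re - r) • (1 : A) + z.im • J‖ := by
        rw [sub_smul, add_sub_right_comm]
    _ ≤ |z.re - r| + |z.im| := by
        refine (norm_add_le _ _).trans_eq ?_
        rw [norm_smul, norm_smul, norm_one' (A := A), (mem_imaginaryUnits_iff.1 hJ).1,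
          Real.norm_eq_abs, Real.norm_eq_abs, mul_one, mul_one]
    _ < ε := hz

lemma star_add_smul (α β : ℝ) {J : A} (hJ : J ∈ imaginaryUnits A) :
    star (α • (1 : A) + β • J) = α • (1 : A) + (-β) • J := by
  rw [star_eq, inner_add_smul_one α β hJ]
  module

/-- The spherical derivative of `f` at `α + βJ` is `β⁻¹ F₂(α + iβ)`. -/
lemma sphericalDerivative_add_smul (hD : ConjInvariant D) (hs : IsStemFunction D F₁ F₂)
    (hf : ∀ α β : ℝ, (⟨α, β⟩ : ℂ) ∈ D → ∀ J ∈ imaginaryUnits A,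
      f (α • (1 : A) + β • J) = F₁ ⟨α, β⟩ + J * F₂ ⟨α, β⟩)
    {α β : ℝ} (hβ : β ≠ 0) (hz : (⟨α, β⟩ : ℂ) ∈ D) {J : A} (hJ : J ∈ imaginaryUnits A) :
    sphericalDerivative f (α • (1 : A) + β • J) = β⁻¹ • F₂ ⟨α, β⟩ := by
  have hz' : (⟨α, -β⟩ : ℂ) ∈ D := hD _ hz
  have h1 : F₁ ⟨α, -β⟩ = F₁ ⟨α, β⟩ := (hs _ hz).1
  have h2 : F₂ ⟨α, -β⟩ = -F₂ ⟨α, β⟩ := (hs _ hz).2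
  have him : imPart (α • (1 : A) + β • J) = β • J := by
    rw [imPart, star_add_smul α β hJ]
    module
  have hbJ : β • J ≠ 0 := by
    rw [← norm_ne_zero_iff, norm_smul, (mem_imaginaryUnits_iff.1 hJ).1]
    simpa using hβ
  have hdiff : F₁ ⟨α, β⟩ + J * F₂ ⟨α, β⟩ - (F₁ ⟨α, β⟩ + J * -F₂ ⟨α, β⟩) =
      (β • J) * ((2 * β⁻¹) • F₂ ⟨α, β⟩) := by
    rw [smul_mul', mul_smul', smul_smul, show β * (2 * β⁻¹) = 2 by field_simp, mul_neg']
    module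
  rw [sphericalDerivative, him, star_add_smul α β hJ, hf _ _ hz J hJ, hf _ _ hz' J hJ, h1, h2,
    hdiff, inv_mul_cancel_left' hbJ, smul_smul]
  congr 1
  ring

lemma add_smul_notMem_realLine {α β : ℝ} (hβ : β ≠ 0) {J : A} (hJ : J ∈ imaginaryUnits A) :
    α • (1 : A) + β • J ∉ realLine A := by
  rintro ⟨r, hr⟩
  obtain ⟨h1, h2⟩ := mem_imaginaryUnits_iff.1 hJ
  have h3 := congrArg (fun x => inner ℝ J x) hr
  simp only [inner_add_right, real_inner_smul_right, h2, real_inner_self_eq_norm_sq, h1] at h3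
  simp at h3
  exact hβ h3

/-! ### The two parts of the theorem. -/

/-- The open mapping theorem for nonconstant slice regular functions on slice domains. -/
theorem isOpenMap_of_isSliceDomain {Ω : Set A} (hreg : SliceRegularOn f Ω)
    (hΩ : IsSliceDomain Ω) (hconst : ¬ IsConstantOn f Ω) :
    IsOpenMap (Set.domRestrict (Ω \ closure (sphericalDerivativeZeros f Ω)) f) ∧
      (∀ U ⊆ Ω, IsCircular U → IsOpen U → IsOpen (f '' U)) ∧ IsOpen (f '' Ω) := by
  obtain ⟨D, hD, hDc, rfl, F₁, F₂, hs, hh, hf⟩ := hreg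
  obtain ⟨D', -, hDc', hconn, ⟨r, hr⟩, heq⟩ := hΩ
  obtain rfl := circularization_injective hDc hDc' heq
  have hne : ∀ y, ∀ z₀ ∈ D, ¬ ∀ᶠ z in 𝓝 z₀, normStem F₁ F₂ y z = 0 := by
    intro y z₀ hz₀ h0
    refine hconst ⟨y, ?_⟩
    rintro _ ⟨α, β, J, hJ, rfl, hz⟩
    obtain ⟨h1, h2⟩ := eq_const_of_normStem_eventually_zero hD hconn.isPreconnected hr hs hh hz₀
      h0 _ hz
    rw [hf α β hz J hJ, h1, h2, mul_zero', add_zero]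
  have hΩo := isOpen_circularization (A := A) hDc hD
  have hcirc : ∀ U ⊆ circularization A D, IsCircular U → IsOpen U → IsOpen (f '' U) := by
    rintro U hU ⟨E, rfl⟩ hUo
    rw [isOpen_iff_mem_nhds]
    rintro _ ⟨_, ⟨α, β, J, hJ, rfl, hz⟩, rfl⟩
    have hx : α • (1 : A) + β • J ∈ circularization A E := ⟨α, β, J, hJ, rfl, hz⟩
    have hzD := (add_smul_mem_circularization_iff hDc hJ).1 (hU hx)
    refine image_mem_nhds_of_forall_imaginaryUnits hD hh hf hzD hJ (hf α β hzD J hJ).symm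
      (hne _ _ hzD) ?_
    have hc : Continuous fun z : ℂ => z.re • (1 : A) + z.im • J := by fun_prop
    filter_upwards [hc.continuousAt.eventually_mem (x := ⟨α, β⟩) (hUo.mem_nhds hx)]
    -- One point of a sphere in a circular set brings in the whole sphere. As `E` need not be
    -- conjugation invariant, `z` or its conjugate may be the point in `E`; in the second case `K`
    -- is replaced by `-K`.
    rintro z ⟨α', β', J', hJ', h1, h2⟩ K hK
    have h3 := congrArg complexCoord h1
    rw [complexCoord_add_smul _ _ hJ, complexCoord_add_smul _ _ hJ'] at h3
    obtain ⟨h4, h5⟩ := Complex.ext_iff.1 h3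
    simp only at h4 h5
    rcases abs_eq_abs.1 h5 with h6 | h6
    · exact ⟨α', β', K, hK, by rw [h4, h6], h2⟩
    · exact ⟨α', β', -K, neg_mem_imaginaryUnits hK, by rw [h4, h6, neg_smul, smul_neg], h2⟩
  -- The closure serves only to make the domain open; at each nonreal point it is enough that the
  -- spherical derivative is nonzero.
  refine ⟨isOpenMap_domRestrict (hΩo.sdiff isClosed_closure) ?_, hcirc,
    hcirc _ Subset.rfl ⟨D, rfl⟩ hΩo⟩
  rintro _ ⟨⟨α, β, J, hJ, rfl, hz⟩, hV⟩ W hW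
  by_cases hβ : β = 0
  · subst hβ
    refine image_mem_nhds_of_forall_imaginaryUnits hD hh hf hz hJ (hf α 0 hz J hJ).symm
      (hne _ _ hz) (eventually_forall_mem_of_real (r := α) ?_)
    simpa using hW
  · refine image_mem_nhds_of_snd_ne_zero hD hh hf hz hJ (hf α β hz J hJ).symm (fun h2 => ?_)
      (hne _ _ hz) hW
    refine hV (subset_closure ⟨⟨⟨α, β, J, hJ, rfl, hz⟩, add_smul_notMem_realLine hβ hJ⟩, ?_⟩)
    rw [sphericalDerivative_add_smul hDc hs hf hβ hz hJ, h2, smul_zero]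

lemma not_eventually_eq_self (α : ℝ) : ¬ ∀ᶠ s in 𝓝 α, s = α := fun h => by
  obtain ⟨s, h1, h2⟩ := ((h.filter_mono nhdsWithin_le_nhds).and
    (self_mem_nhdsWithin (s := {α}ᶜ))).exists
  exact h2 h1

/-- The open mapping theorem for slice regular functions with discrete fibers. -/
theorem isOpenMap_of_discrete_fibers (hA : 2 < Module.finrank ℝ A) {Ω : Set A}
    (hreg : SliceRegularOn f Ω)
    (hdisc : ∀ y ∈ f '' Ω, DiscreteTopology ↥(Ω ∩ f ⁻¹' {y})) :
    IsOpenMap (Set.domRestrict Ω f) := by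
  obtain ⟨D, hD, hDc, rfl, F₁, F₂, hs, hh, hf⟩ := hreg
  have hiso : ∀ x ∈ circularization A D,
      ∀ᶠ x' in 𝓝 x, x' ∈ circularization A D → f x' = f x → x' = x := by
    intro x hx
    have h1 := discreteTopology_subtype_iff.1 (hdisc _ ⟨x, hx, rfl⟩) x ⟨hx, rfl⟩
    rw [← disjoint_iff, disjoint_principal_right, mem_nhdsWithin_iff_eventually] at h1
    filter_upwards [h1] with x' h2 h3 h4
    by_contra h5
    exact h2 h5 ⟨h3, h4⟩
  refine isOpenMap_domRestrict (isOpen_circularization hDc hD) ?_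
  rintro _ ⟨α, β, J, hJ, rfl, hz⟩ W hW
  have hfx := hf α β hz J hJ
  have hx := hiso _ ⟨α, β, J, hJ, rfl, hz⟩
  by_cases hβ : β = 0
  · subst hβ
    refine image_mem_nhds_of_forall_imaginaryUnits hD hh hf hz hJ hfx.symm (fun h0 => ?_)
      (eventually_forall_mem_of_real (r := α) (by simpa using hW))
    have hcC : Tendsto (fun s : ℝ => (s : ℂ)) (𝓝 α) (𝓝 ⟨α, 0⟩) :=
      Complex.continuous_ofReal.tendsto α
    have hcA : Tendsto (fun s : ℝ => s • (1 : A) + (0 : ℝ) • J) (𝓝 α)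
        (𝓝 (α • (1 : A) + (0 : ℝ) • J)) := Continuous.tendsto (by fun_prop) α
    -- If the normal function vanished near a real point, `f` would be constant on a real interval,
    -- against discreteness of the fiber.
    have hev : ∀ᶠ s : ℝ in 𝓝 α, s = α := by
      filter_upwards [hcC.eventually h0, hcC.eventually (hD.mem_nhds hz), hcA.eventually hx]
        with s h1 h2 h3
      have h4 : f (s • (1 : A) + (0 : ℝ) • J) = f (α • (1 : A) + (0 : ℝ) • J) := by
        rw [hf s 0 h2 J hJ]
        change F₁ (s : ℂ) + J * F₂ (s : ℂ) = _
        rw [fst_eq_of_normStem_eq_zero hs h2 h1, IsStemFunction.snd_ofReal hs h2, mul_zero',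
          add_zero]
      have h5 := congrArg (fun x => inner ℝ x 1) (h3 ⟨s, 0, J, hJ, rfl, h2⟩ h4)
      simpa only [inner_add_smul_one _ _ hJ] using h5
    exact not_eventually_eq_self α hev
  -- Otherwise `f` is constant on the sphere through the point, which has no isolated points when
  -- `dim A > 2`.
  have h2 : F₂ ⟨α, β⟩ ≠ 0 := by
    intro h2
    obtain ⟨K, hK, hK'⟩ := exists_tendsto_imaginaryUnits hA hJ
    have hc : Tendsto (fun t => α • (1 : A) + β • K t) (𝓝[>] 0) (𝓝 (α • (1 : A) + β • J)) :=
      tendsto_const_nhds.add (hK.const_smul β)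
    obtain ⟨t, h3, h4, h5⟩ := ((hc.eventually hx).and hK').exists
    refine h5 (smul_right_injective A hβ (add_left_cancel
      (h3 ⟨α, β, K t, h4, rfl, hz⟩ ?_)))
    rw [hf α β hz _ h4, hfx, h2, mul_zero', mul_zero']
  refine image_mem_nhds_of_snd_ne_zero hD hh hf hz hJ hfx.symm h2 (fun h0 => ?_) hW
  -- If the normal function vanished near `z₀`, the fiber would meet the sphere over each `s + iβ`
  -- with `s` near `α`. Continuity of `J` puts these points close to the given one, and isolation
  -- forces `s = α`.
  have hcC : Tendsto (fun s : ℝ => (⟨s, β⟩ : ℂ)) (𝓝 α) (𝓝 ⟨α, β⟩) := by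
    have : (fun s : ℝ => (⟨s, β⟩ : ℂ)) = fun s : ℝ => (s : ℂ) + β * Complex.I := by
      ext s
      exact Complex.mk_eq_add_mul_I _ _
    rw [Complex.mk_eq_add_mul_I, this]
    exact Continuous.tendsto (by fun_prop) α
  have hev := (tendsto_const_nhds.prodMk hcC).eventually
    (eventually_add_smul_mem hD hh hz hfx.symm h2 hx)
  refine not_eventually_eq_self α ?_
  filter_upwards [hev, hcC.eventually h0, hcC.eventually (hD.mem_nhds hz)] with s h3 h4 h5
  obtain ⟨K, hK, hy⟩ := normStem_eq_zero_iff.1 h4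
  have h6 := h3 K hy ⟨s, β, K, hK, rfl, h5⟩ ((hf s β h5 K hK).trans hy)
  have h7 := congrArg (fun x => inner ℝ x 1) h6
  simpa only [inner_add_smul_one _ _ hK, inner_add_smul_one _ _ hJ] using h7

end NormedCompositionAlgebra



/-! ### The three algebras as composition algebras. -/

instance : NormedCompositionAlgebra ℂ where
  add_mul' := add_mul
  mul_add' := mul_add
  smul_mul' := smul_mul_assoc
  mul_smul' := mul_smul_comm
  mul_one' := mul_one
  one_mul' := one_mul
  norm_mul' := norm_mul
  norm_one' := norm_one
  star_eq x := by apply Complex.ext <;> simp [two_mul]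
  inv_eq x := by
    rw [Complex.inv_def, Complex.normSq_eq_norm_sq, Complex.real_smul, mul_comm]
    rfl
  star_mul_mul x y := by
    rw [← mul_assoc, Complex.real_smul, ← Complex.normSq_eq_norm_sq, Complex.normSq_eq_conj_mul_self]
    rfl
  mul_star_mul x y := by
    rw [mul_assoc, Complex.real_smul, ← Complex.normSq_eq_norm_sq, Complex.normSq_eq_conj_mul_self,
      mul_comm]
    rfl
  exists_imaginaryUnit := ⟨Complex.I, Complex.I_mul_I⟩

lemma quaternion_norm_sq (x : Quaternion ℝ) :
    ‖x‖ ^ 2 = x.re ^ 2 + x.imI ^ 2 + x.imJ ^ 2 + x.imK ^ 2 := by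
  rw [pow_two, ← Quaternion.normSq_eq_norm_mul_self, Quaternion.normSq_def']

lemma quaternion_star_mul_self (x : Quaternion ℝ) :
    star x * x = ((‖x‖ ^ 2 : ℝ) : Quaternion ℝ) := by
  rw [Quaternion.star_mul_self, Quaternion.normSq_eq_norm_mul_self, pow_two]

lemma quaternion_self_mul_star (x : Quaternion ℝ) :
    x * star x = ((‖x‖ ^ 2 : ℝ) : Quaternion ℝ) := by
  rw [Quaternion.self_mul_star, Quaternion.normSq_eq_norm_mul_self, pow_two]

instance : NormedCompositionAlgebra (Quaternion ℝ) where
  add_mul' := add_mul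
  mul_add' := mul_add
  smul_mul' := smul_mul_assoc
  mul_smul' := mul_smul_comm
  mul_one' := mul_one
  one_mul' := one_mul
  norm_mul' := norm_mul
  norm_one' := norm_one
  star_eq x := by
    ext <;> simp [Quaternion.inner_def, two_mul, Quaternion.re_one, Quaternion.imI_one,
      Quaternion.imJ_one, Quaternion.imK_one]
  inv_eq x := by
    rw [Quaternion.inv_def, Quaternion.normSq_eq_norm_mul_self, pow_two]
  star_mul_mul x y := by
    rw [← mul_assoc, quaternion_star_mul_self, Quaternion.coe_mul_eq_smul]
  mul_star_mul x y := by
    rw [mul_assoc, quaternion_star_mul_self, Quaternion.mul_coe_eq_smul]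
  exists_imaginaryUnit := ⟨((Complex.I : ℂ) : Quaternion ℝ), by
    rw [← Quaternion.coeComplex_mul, Complex.I_mul_I]
    ext <;> simp [Quaternion.re_one, Quaternion.imI_one, Quaternion.imJ_one, Quaternion.imK_one]⟩

end Slice

namespace Octonion

lemma ext {x y : Octonion} (h1 : x.fst = y.fst) (h2 : x.snd = y.snd) : x = y :=
  WithLp.ofLp_injective 2 (Prod.ext h1 h2)

@[simp] lemma fst_mul (x y : Octonion) : (x * y).fst = x.fst * y.fst - y.snd * star x.snd := rfl
@[simp] lemma snd_mul (x y : Octonion) : (x * y).snd = star x.fst * y.snd + y.fst * x.snd := rfl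
@[simp] lemma fst_add (x y : Octonion) : (x + y).fst = x.fst + y.fst := rfl
@[simp] lemma snd_add (x y : Octonion) : (x + y).snd = x.snd + y.snd := rfl
@[simp] lemma fst_sub (x y : Octonion) : (x - y).fst = x.fst - y.fst := rfl
@[simp] lemma snd_sub (x y : Octonion) : (x - y).snd = x.snd - y.snd := rfl
@[simp] lemma fst_smul (r : ℝ) (x : Octonion) : (r • x).fst = r • x.fst := rfl
@[simp] lemma snd_smul (r : ℝ) (x : Octonion) : (r • x).snd = r • x.snd := rfl
@[simp] lemma fst_one : (1 : Octonion).fst = 1 := rfl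
@[simp] lemma snd_one : (1 : Octonion).snd = 0 := rfl
@[simp] lemma fst_star (x : Octonion) : (star x).fst = star x.fst := rfl
@[simp] lemma snd_star (x : Octonion) : (star x).snd = -x.snd := rfl

lemma norm_sq (x : Octonion) : ‖x‖ ^ 2 = ‖x.fst‖ ^ 2 + ‖x.snd‖ ^ 2 :=
  WithLp.prod_norm_sq_eq_of_L2 x

lemma inner_eq (x y : Octonion) :
    inner ℝ x y = inner ℝ x.fst y.fst + inner ℝ x.snd y.snd := rfl

instance : Slice.NormedCompositionAlgebra Octonion where
  add_mul' x y z := by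
    apply ext
    · simp only [fst_mul, fst_add, snd_add, star_add]; noncomm_ring
    · simp only [snd_mul, fst_add, snd_add, star_add]; noncomm_ring
  mul_add' x y z := by
    apply ext
    · simp only [fst_mul, fst_add, snd_add]; noncomm_ring
    · simp only [snd_mul, fst_add, snd_add]; noncomm_ring
  smul_mul' r x y := by
    apply ext <;> simp [smul_sub, smul_add]
  mul_smul' r x y := by
    apply ext <;> simp [smul_sub, smul_add]
  mul_one' x := by apply ext <;> simp
  one_mul' x := by apply ext <;> simp
  norm_mul' x y := by
    -- Degen's eight-square identity, checked in real coordinates.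
    have h : ‖x * y‖ ^ 2 = (‖x‖ * ‖y‖) ^ 2 := by
      rw [mul_pow]
      simp only [norm_sq, Slice.quaternion_norm_sq, fst_mul, snd_mul, Quaternion.re_add,
        Quaternion.imI_add, Quaternion.imJ_add, Quaternion.imK_add, Quaternion.re_sub,
        Quaternion.imI_sub, Quaternion.imJ_sub, Quaternion.imK_sub, Quaternion.re_mul,
        Quaternion.imI_mul, Quaternion.imJ_mul, Quaternion.imK_mul, Quaternion.re_star,
        Quaternion.imI_star, Quaternion.imJ_star, Quaternion.imK_star]
      ring
    exact (pow_left_inj₀ (norm_nonneg _) (by positivity) two_ne_zero).1 h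
  norm_one' := by
    have h := norm_sq 1
    rw [fst_one, snd_one, norm_one (α := Quaternion ℝ), norm_zero] at h
    exact (pow_eq_one_iff_of_nonneg (norm_nonneg _) two_ne_zero).1 (h.trans (by norm_num))
  star_eq x := by
    apply ext <;> ext <;> simp [inner_eq, Quaternion.inner_def, two_mul, Quaternion.re_one, Quaternion.imI_one,
      Quaternion.imJ_one, Quaternion.imK_one]
  inv_eq x := rfl
  star_mul_mul x y := by
    apply ext
    · have h : (star x * (x * y)).fst = star x.fst * x.fst * y.fst + y.fst * (x.snd * star x.snd) := by
        simp only [fst_mul, snd_mul, fst_star, snd_star, star_neg]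
        noncomm_ring
      rw [h, Slice.quaternion_star_mul_self, Slice.quaternion_self_mul_star, Quaternion.coe_mul_eq_smul, Quaternion.mul_coe_eq_smul,
        fst_smul, norm_sq, add_smul]
    · have h : (star x * (x * y)).snd = x.fst * star x.fst * y.snd + y.snd * (star x.snd * x.snd) := by
        simp only [fst_mul, snd_mul, fst_star, snd_star, star_star]
        noncomm_ring
      rw [h, Slice.quaternion_star_mul_self, Slice.quaternion_self_mul_star, Quaternion.coe_mul_eq_smul, Quaternion.mul_coe_eq_smul,
        snd_smul, norm_sq, add_smul]
  mul_star_mul x y := by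
    apply ext
    · have h : (x * star y * y).fst = x.fst * (star y.fst * y.fst) + y.snd * star y.snd * x.fst := by
        simp only [fst_mul, snd_mul, fst_star, snd_star, star_add, star_mul, star_neg, star_star]
        noncomm_ring
      rw [h, Slice.quaternion_star_mul_self, Slice.quaternion_self_mul_star, Quaternion.coe_mul_eq_smul, Quaternion.mul_coe_eq_smul,
        fst_smul, norm_sq, add_smul]
    · have h : (x * star y * y).snd = y.fst * star y.fst * x.snd + x.snd * (star y.snd * y.snd) := by
        simp only [fst_mul, snd_mul, fst_star, snd_star, star_sub, star_mul, star_neg, star_star]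
        noncomm_ring
      rw [h, Slice.quaternion_star_mul_self, Slice.quaternion_self_mul_star, Quaternion.coe_mul_eq_smul, Quaternion.mul_coe_eq_smul,
        snd_smul, norm_sq, add_smul]
  exists_imaginaryUnit := by
    obtain ⟨q, hq⟩ := Slice.NormedCompositionAlgebra.exists_imaginaryUnit (A := Quaternion ℝ)
    refine ⟨mk q 0, ext ?_ ?_⟩
    · change q * q - 0 * star 0 = -1
      rw [hq, zero_mul, sub_zero]
    · change star q * 0 + q * 0 = -0
      simp

lemma finrank_eq_eight : Module.finrank ℝ Octonion = 8 := by
  have h : Module.finrank ℝ (WithLp 2 (Quaternion ℝ × Quaternion ℝ)) = 8 := by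
    rw [(WithLp.linearEquiv 2 ℝ (Quaternion ℝ × Quaternion ℝ)).finrank_eq, Module.finrank_prod,
      Quaternion.finrank_eq_four]
  exact h

end Octonion

/-! ### Discrete fibers over `ℂ`, and the conclusion. -/

namespace Slice

/-- Taking `J = i` gives `Ω = D` and `f = F₁ + iF₂` with complex valued `F₁`, `F₂`; the
Cauchy-Riemann equations for the pair make this sum holomorphic. -/
lemma SliceRegularOn.isOpen_and_differentiableOn {f : ℂ → ℂ} {Ω : Set ℂ}
    (h : SliceRegularOn f Ω) : IsOpen Ω ∧ DifferentiableOn ℂ f Ω := by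
  obtain ⟨D, hD, hDc, rfl, F₁, F₂, hs, hh, hf⟩ := h
  have hI : Complex.I ∈ imaginaryUnits ℂ := Complex.I_mul_I
  have hpt : ∀ z : ℂ, z = z.re • (1 : ℂ) + z.im • Complex.I := fun z => by
    simp [Complex.re_add_im]
  have hΩ : circularization ℂ D = D := by
    ext z
    nth_rewrite 1 [hpt z]
    exact NormedCompositionAlgebra.add_smul_mem_circularization_iff hDc hI
  rw [hΩ]
  refine ⟨hD, fun z hz => DifferentiableAt.differentiableWithinAt ?_⟩
  have hfz : f =ᶠ[𝓝 z] fun w => F₁ w + Complex.I * F₂ w := by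
    filter_upwards [hD.mem_nhds hz] with w hw
    nth_rewrite 1 [hpt w]
    exact hf w.re w.im hw _ hI
  refine DifferentiableAt.congr_of_eventuallyEq ?_ hfz
  obtain ⟨h1, h2⟩ := NormedCompositionAlgebra.IsHolomorphicPair.differentiableAt hD hh hz
  have hcr := hh.2.2 z hz
  have h3 := h1.hasFDerivAt.fun_add (h2.hasFDerivAt.const_mul Complex.I)
  rw [differentiableAt_complex_iff_differentiableAt_real]
  refine ⟨h3.differentiableAt, ?_⟩
  rw [h3.fderiv]
  simp only [add_apply, smul_apply, hcr.1, hcr.2, smul_eq_mul]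
  linear_combination -fderiv ℝ F₂ z 1 * Complex.I_mul_I

/-- The open mapping theorem for holomorphic functions with discrete fibers. -/
theorem isOpenMap_of_discrete_fibers_complex {f : ℂ → ℂ} {Ω : Set ℂ} (hreg : SliceRegularOn f Ω)
    (hdisc : ∀ y ∈ f '' Ω, DiscreteTopology ↥(Ω ∩ f ⁻¹' {y})) :
    IsOpenMap (Set.domRestrict Ω f) := by
  obtain ⟨hΩ, hd⟩ := hreg.isOpen_and_differentiableOn
  refine isOpenMap_domRestrict hΩ fun z hz W hW => ?_
  rcases (hd.analyticAt (hΩ.mem_nhds hz)).eventually_constant_or_nhds_le_map_nhds with h | h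
  -- A locally constant `f` would have a whole neighborhood of `z` in its fiber.
  · have h1 := discreteTopology_subtype_iff.1 (hdisc _ ⟨z, hz, rfl⟩) z ⟨hz, rfl⟩
    rw [← disjoint_iff, disjoint_principal_right] at h1
    have h2 : ∀ᶠ w in 𝓝[≠] z, w ∈ Ω ∩ f ⁻¹' {f z} :=
      nhdsWithin_le_nhds ((hΩ.eventually_mem hz).and h)
    obtain ⟨w, h3, h4⟩ := (h2.and h1).exists
    exact absurd h3 h4
  · exact h (image_mem_map hW)

end Slice

theorem mainTheorem1 :
    (∀ (Ω : Set ℂ) (f : ℂ → ℂ), Slice.SliceRegularOn f Ω →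
      (Slice.IsSliceDomain Ω → ¬ Slice.IsConstantOn f Ω →
        IsOpenMap (Set.domRestrict (Ω \ closure (Slice.sphericalDerivativeZeros f Ω)) f) ∧
        (∀ U ⊆ Ω, Slice.IsCircular U → IsOpen U → IsOpen (f '' U)) ∧
        IsOpen (f '' Ω)) ∧
      ((∀ y ∈ f '' Ω, DiscreteTopology ↥(Ω ∩ f ⁻¹' {y})) → IsOpenMap (Set.domRestrict Ω f))) ∧
    (∀ (Ω : Set (Quaternion ℝ)) (f : Quaternion ℝ → Quaternion ℝ), Slice.SliceRegularOn f Ω →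
      (Slice.IsSliceDomain Ω → ¬ Slice.IsConstantOn f Ω →
        IsOpenMap (Set.domRestrict (Ω \ closure (Slice.sphericalDerivativeZeros f Ω)) f) ∧
        (∀ U ⊆ Ω, Slice.IsCircular U → IsOpen U → IsOpen (f '' U)) ∧
        IsOpen (f '' Ω)) ∧
      ((∀ y ∈ f '' Ω, DiscreteTopology ↥(Ω ∩ f ⁻¹' {y})) → IsOpenMap (Set.domRestrict Ω f))) ∧
    (∀ (Ω : Set Octonion) (f : Octonion → Octonion), Slice.SliceRegularOn f Ω →
      (Slice.IsSliceDomain Ω → ¬ Slice.IsConstantOn f Ω →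
        IsOpenMap (Set.domRestrict (Ω \ closure (Slice.sphericalDerivativeZeros f Ω)) f) ∧
        (∀ U ⊆ Ω, Slice.IsCircular U → IsOpen U → IsOpen (f '' U)) ∧
        IsOpen (f '' Ω)) ∧
      ((∀ y ∈ f '' Ω, DiscreteTopology ↥(Ω ∩ f ⁻¹' {y})) → IsOpenMap (Set.domRestrict Ω f))) := by

  refine ⟨fun Ω f h => ⟨fun h1 h2 => ?_, fun h1 => ?_⟩, fun Ω f h => ⟨fun h1 h2 => ?_, fun h1 => ?_⟩,
    fun Ω f h => ⟨fun h1 h2 => ?_, fun h1 => ?_⟩⟩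
  · exact Slice.NormedCompositionAlgebra.isOpenMap_of_isSliceDomain h h1 h2
  · exact Slice.isOpenMap_of_discrete_fibers_complex h h1
  · exact Slice.NormedCompositionAlgebra.isOpenMap_of_isSliceDomain h h1 h2
  · exact Slice.NormedCompositionAlgebra.isOpenMap_of_discrete_fibers
      (by rw [Quaternion.finrank_eq_four]; norm_num) h h1
  · exact Slice.NormedCompositionAlgebra.isOpenMap_of_isSliceDomain h h1 h2
  · exact Slice.NormedCompositionAlgebra.isOpenMap_of_discrete_fibers
      (by rw [Octonion.finrank_eq_eight]; norm_num) h h1
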